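/- Let $G=(V,E)$ be a directed graph, possibly infinite, in which parallel edges and loops are allowed. A path is a finite directed path without repeated vertices (a single vertex is a path), and a ray is a one-way infinite directed path $v_0\to v_1\to v_2\to\cdots$ without repeated vertices, starting in $v_0$. Let $b\in V$. A vertex $v$ dominates $b$ if $G$ contains infinitely many pairwise edge-disjoint paths from $v$ to $b$; a path dominates $b$ if its last vertex does; and a ray $R$ dominates $b$ if $G$ contains infinitely many pairwise edge-disjoint paths that start at a vertex of $R$ and end in $b$. For $S,I\subseteq V$, a linkage from $S$ into $b$ is a family $(P_s)_{s\in S}$ of pairwise edge-disjoint paths such that $P_s$ starts in $s$ and ends in $b$, and a domination linkage from $I$ to $b$ is a family $(Q_a)_{a\in I}$ of pairwise edge-disjoint paths or rays such that $Q_a$ starts in $a$ and either is a path ending in $b$ or dominates $b$. **Theorem.** Let $G$ be a directed graph, $b\in V(G)$ and $I\subseteq V(G)\setminus\{b\}$. There is a domination linkage from $I$ to $b$ if and only if for every finite subset $S$ of $I$ there is a linkage from $S$ into $b$. -/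

import Mathlib

/-- A directed graph with vertex set `V` and edge set `E`: every edge has an initial and a terminal
vertex. Parallel edges and loops are allowed; `V` and `E` may be infinite of any cardinality. -/
structure MultiDigraph (V : Type*) (E : Type*) where
  /-- the initial vertex of an edge -/
  init : E → V
  /-- the terminal vertex of an edge -/
  ter : E → V

namespace MultiDigraph

/-- The list of edges `es` is traversed, in this order and each edge in its own direction, by a
finite directed walk from `u` to `v`. -/
def IsWalk {V E : Type*} (G : MultiDigraph V E) : V → List E → V → Prop
  | u, [], v => u = v
  | u, e :: es, v => G.init e = u ∧ G.IsWalk (G.ter e) es v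

/-- A (finite) directed path: a finite directed walk that visits no vertex twice.
A single vertex, without edges, is a path. -/
@[ext]
structure DiPath {V E : Type*} (G : MultiDigraph V E) where
  /-- the first vertex -/
  first : V
  /-- the edges in the order of the path -/
  edges : List E
  /-- the last vertex -/
  last : V
  isWalk : G.IsWalk first edges last
  nodup : (first :: edges.map G.ter).Nodup

/-- The set of edges of a directed path. -/
def DiPath.edgeSet {V E : Type*} {G : MultiDigraph V E} (P : G.DiPath) : Set E :=
  {e | e ∈ P.edges}

/-- A directed ray: a one-way infinite directed path `vert 0, edge 0, vert 1, edge 1, …` that visits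
no vertex twice. -/
structure DiRay {V E : Type*} (G : MultiDigraph V E) where
  /-- the vertices in the order of the ray -/
  vert : ℕ → V
  /-- the edges in the order of the ray -/
  edge : ℕ → E
  init_edge : ∀ n, G.init (edge n) = vert n
  ter_edge : ∀ n, G.ter (edge n) = vert (n + 1)
  injective : Function.Injective vert

/-- Something that is either a directed path or a directed ray. -/
inductive PathOrRay {V E : Type*} (G : MultiDigraph V E) where
  | path (P : G.DiPath) : PathOrRay G
  | ray (R : G.DiRay) : PathOrRay G

/-- The first vertex of a path or ray. -/
def PathOrRay.first {V E : Type*} {G : MultiDigraph V E} : G.PathOrRay → V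
  | .path P => P.first
  | .ray R => R.vert 0

/-- The set of edges of a path or ray. -/
def PathOrRay.edgeSet {V E : Type*} {G : MultiDigraph V E} : G.PathOrRay → Set E
  | .path P => P.edgeSet
  | .ray R => Set.range R.edge

/-- The graph contains infinitely many edge-disjoint directed paths from `X` to `B`. These form a
set of paths, so a path without edges is counted only once. -/
def InfinitelyManyPaths {V E : Type*} (G : MultiDigraph V E) (X B : Set V) : Prop :=
  ∃ L : Set G.DiPath, L.Infinite ∧
    (∀ P ∈ L, P.first ∈ X ∧ P.last ∈ B) ∧
    (∀ P ∈ L, ∀ Q ∈ L, P ≠ Q → Disjoint P.edgeSet Q.edgeSet)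

/-- The vertex `v` dominates `B`: there are infinitely many edge-disjoint directed paths from `v`
to `B`. -/
def VertexDominates {V E : Type*} (G : MultiDigraph V E) (v : V) (B : Set V) : Prop :=
  G.InfinitelyManyPaths {v} B

/-- A path dominates `B` if its last vertex does. -/
def DiPath.Dominates {V E : Type*} {G : MultiDigraph V E} (P : G.DiPath) (B : Set V) : Prop :=
  G.VertexDominates P.last B

/-- A ray dominates `B`: there are infinitely many edge-disjoint directed paths from the ray
to `B`. -/
def DiRay.Dominates {V E : Type*} {G : MultiDigraph V E} (R : G.DiRay) (B : Set V) : Prop :=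
  G.InfinitelyManyPaths (Set.range R.vert) B

/-- A path or ray ends in a vertex of `B` (this applies to paths only) or dominates `B`. -/
def PathOrRay.EndsInOrDominates {V E : Type*} {G : MultiDigraph V E} (B : Set V) :
    G.PathOrRay → Prop
  | .path P => P.last ∈ B ∨ P.Dominates B
  | .ray R => R.Dominates B

/-- A linkage from `A` to `B` : edge-disjoint directed paths from the whole of `A` to `B`, written
as a family indexed by the first vertices of the paths. -/
structure IsLinkage {V E : Type*} {G : MultiDigraph V E} (A B : Set V) (P : A → G.DiPath) :
    Prop where
  first_eq : ∀ a : A, (P a).first = a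
  last_mem : ∀ a : A, (P a).last ∈ B
  disjoint : ∀ a a' : A, a ≠ a' → Disjoint (P a).edgeSet (P a').edgeSet

/-- An (edge-disjoint) domination linkage from `A` to `B` : a family `(Q a | a ∈ A)` of edge-disjoint
directed paths or rays where `Q a` starts in `a` and ends in `B` or dominates `B`. -/
structure IsDominationLinkage {V E : Type*} {G : MultiDigraph V E} (A B : Set V)
    (Q : A → G.PathOrRay) : Prop where
  first_eq : ∀ a : A, (Q a).first = a
  ends_or_dominates : ∀ a : A, (Q a).EndsInOrDominates B
  disjoint : ∀ a a' : A, a ≠ a' → Disjoint (Q a).edgeSet (Q a').edgeSet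

end MultiDigraph

/-! Both sides are equivalent to `CutCondition`: a set avoiding `b` with finitely many outgoing
edges contains at most as many sources as it has outgoing edges. It is necessary because each member
of either kind of linkage must leave such a set if it starts there. Conversely, it yields finite
linkages by Menger's theorem (`exists_isFlow`); the work lies in building a domination linkage.

Sources are added, with multiplicity, until the cut condition admits no more
(`CutCondition.exists_maximal`). Then every vertex separated from `b` by a finite cut is covered,
that is, lies in a tight set (`exists_tight_of_maximal`), and hence in a least one, its hull. For
each tight set fix a finite linkage of its sources; it never enters a tight subset and uses all
edges leaving one.

The trail from a source always follows the linkage of the hull of its current vertex. By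
`Next.subset_and_good` hulls only grow, and the edge just used lies on the linkage of the new hull.
Steps are uniquely reversible (`Next.left_unique`), so trails are edge-disjoint; growing hulls
exclude repeated vertices. A trail stops at its first uncovered vertex, which is `b` or dominates
`b`. An endless trail leaves every tight set (`trail_not_subset_tight`), while every set avoiding
`b` with finitely many outgoing edges lies in a tight one (`exists_tight_superset`), so the ray
dominates `b`. -/

namespace MultiDigraph

/-! ### Walks, paths and reachability -/

section Walks

variable {V E : Type*} {G : MultiDigraph V E}

/-- The set of edges leaving a set of vertices. -/
def outEdges (G : MultiDigraph V E) (X : Set V) : Set E :=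
  {e | G.init e ∈ X ∧ G.ter e ∉ X}

theorem IsWalk.exists_mem_outEdges {X : Set V} {es : List E} {u v : V}
    (h : G.IsWalk u es v) (hu : u ∈ X) (hv : v ∉ X) : ∃ e ∈ es, e ∈ G.outEdges X := by
  induction es generalizing u with
  | nil => exact absurd ((show u = v from h) ▸ hu) hv
  | cons e es ih =>
    obtain ⟨he, h⟩ := h
    by_cases hX : G.ter e ∈ X
    · obtain ⟨e', he', hX'⟩ := ih h hX
      exact ⟨e', List.mem_cons_of_mem _ he', hX'⟩
    · exact ⟨e, List.mem_cons_self, he ▸ hu, hX⟩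

theorem IsWalk.sum_sub {es : List E} {u v : V} (h : G.IsWalk u es v) (φ : V → ℤ) :
    (es.map fun e => φ (G.init e) - φ (G.ter e)).sum = φ u - φ v := by
  induction es generalizing u with
  | nil => simp [show u = v from h]
  | cons e es ih =>
    obtain ⟨rfl, h⟩ := h
    simp [ih h]

theorem IsWalk.append {es es' : List E} {u v w : V} (h : G.IsWalk u es v)
    (h' : G.IsWalk v es' w) : G.IsWalk u (es ++ es') w := by
  induction es generalizing u with
  | nil => rw [show u = v from h]; exact h'
  | cons e es ih => exact ⟨h.1, ih h.2⟩

theorem IsWalk.exists_suffix {es : List E} {u v w : V} (h : G.IsWalk u es v)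
    (hn : (u :: es.map G.ter).Nodup) (hw : w ∈ u :: es.map G.ter) :
    ∃ es', es' <:+ es ∧ G.IsWalk w es' v ∧ (w :: es'.map G.ter).Nodup := by
  induction es generalizing u with
  | nil =>
    obtain rfl : w = u := by simpa using hw
    exact ⟨[], List.suffix_rfl, h, hn⟩
  | cons e es ih =>
    rcases List.mem_cons.1 hw with rfl | hw
    · exact ⟨e :: es, List.suffix_rfl, h, hn⟩
    · obtain ⟨es', hs, h', hn'⟩ := ih h.2 (List.nodup_cons.1 hn).2 hw
      exact ⟨es', hs.trans (List.suffix_cons _ _), h', hn'⟩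

/-- Every walk contains a path between its end vertices. -/
theorem IsWalk.exists_diPath {es : List E} {u v : V} (h : G.IsWalk u es v) :
    ∃ P : G.DiPath, P.first = u ∧ P.last = v ∧ P.edges ⊆ es := by
  induction es generalizing u with
  | nil => exact ⟨⟨u, [], v, h, by simp⟩, rfl, rfl, by simp⟩
  | cons e es ih =>
    obtain ⟨P, hf, hl, hP⟩ := ih h.2
    by_cases hu : u ∈ P.first :: P.edges.map G.ter
    · obtain ⟨es', hs, h', hn⟩ := P.isWalk.exists_suffix P.nodup hu
      exact ⟨⟨u, es', P.last, h', hn⟩, rfl, hl,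
        fun x hx => List.mem_cons_of_mem _ (hP (hs.subset hx))⟩
    · refine ⟨⟨u, e :: P.edges, P.last, ⟨h.1, hf ▸ P.isWalk⟩, ?_⟩, rfl, hl, ?_⟩
      · rw [List.map_cons, ← hf]
        exact List.nodup_cons.2 ⟨hu, P.nodup⟩
      · intro x hx
        rcases List.mem_cons.1 hx with rfl | hx
        · exact List.mem_cons_self
        · exact List.mem_cons_of_mem _ (hP hx)

theorem DiPath.nodup_edges (P : G.DiPath) : P.edges.Nodup :=
  List.Nodup.of_map _ (List.nodup_cons.1 P.nodup).2

/-- The vertices reachable from `R` by walks all of whose edges satisfy `p`. -/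
def reachable (G : MultiDigraph V E) (p : E → Prop) (R : Set V) : Set V :=
  {v | ∃ u ∈ R, ∃ es, G.IsWalk u es v ∧ ∀ e ∈ es, p e}

theorem subset_reachable (p : E → Prop) (R : Set V) : R ⊆ G.reachable p R :=
  fun u hu => ⟨u, hu, [], rfl, by simp⟩

theorem ter_mem_reachable {p : E → Prop} {R : Set V} {e : E}
    (h : G.init e ∈ G.reachable p R) (he : p e) : G.ter e ∈ G.reachable p R := by
  obtain ⟨u, hu, es, hw, hp⟩ := h
  refine ⟨u, hu, es ++ [e], hw.append ⟨rfl, rfl⟩, ?_⟩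
  intro x hx
  rcases List.mem_append.1 hx with hx | hx
  · exact hp x hx
  · rw [List.mem_singleton.1 hx]; exact he

end Walks

/-! ### Finite flows and Menger's theorem -/

section Flows

open Finset Classical

variable {V E J : Type*} {G : MultiDigraph V E} {b : V} {f : J → V}

/-- The finite edge set `F` is an integral unit-capacity flow that sends one unit from `f s` to `b`
for each `s ∈ S`, expressed by testing against all potentials. -/
def IsFlow (G : MultiDigraph V E) (b : V) (f : J → V) (S : Finset J) (F : Finset E) : Prop :=
  ∀ φ : V → ℤ, ∑ e ∈ F, (φ (G.init e) - φ (G.ter e)) = ∑ s ∈ S, (φ (f s) - φ b)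

/-- A flow through a set of vertices: what leaves is what starts inside plus what enters. -/
theorem IsFlow.card_eq {S : Finset J} {F : Finset E} (h : G.IsFlow b f S F) {X : Set V}
    (hb : b ∉ X) :
    #{e ∈ F | e ∈ G.outEdges X} = #{s ∈ S | f s ∈ X} + #{e ∈ F | e ∈ G.outEdges Xᶜ} := by
  -- Against the indicator of `X`, only edges across its boundary contribute.
  have h1 := h (fun v => if v ∈ X then 1 else 0)
  simp only [hb, if_false, sub_zero] at h1
  rw [Finset.sum_boole] at h1
  have h2 : ∑ e ∈ F, (((if G.init e ∈ X then 1 else 0) - (if G.ter e ∈ X then 1 else 0) : ℤ))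
      = ∑ e ∈ F, ((if e ∈ G.outEdges X then 1 else 0) -
        (if e ∈ G.outEdges Xᶜ then 1 else 0) : ℤ) := by
    refine Finset.sum_congr rfl fun e _ => ?_
    by_cases h1 : G.init e ∈ X <;> by_cases h2 : G.ter e ∈ X <;> simp [outEdges, h1, h2]
  rw [h2, Finset.sum_sub_distrib, Finset.sum_boole, Finset.sum_boole] at h1
  zify
  linarith

/-- A flow saturates every tight cut, and does not use edges entering it. -/
theorem IsFlow.saturates {S : Finset J} {F : Finset E} (h : G.IsFlow b f S F) {X : Set V}
    (hb : b ∉ X) (hX : (G.outEdges X).Finite)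
    (hc : (G.outEdges X).ncard ≤ #{s ∈ S | f s ∈ X}) :
    G.outEdges X ⊆ ↑F ∧ ∀ e ∈ F, e ∉ G.outEdges Xᶜ := by
  have h1 := h.card_eq hb
  have hsub : ((({e ∈ F | e ∈ G.outEdges X} : Finset E)) : Set E) ⊆ G.outEdges X :=
    fun e he => (Finset.mem_filter.1 he).2
  have h2 := Set.ncard_le_ncard hsub hX
  rw [Set.ncard_coe_finset] at h2
  constructor
  · have := Set.eq_of_subset_of_ncard_le hsub (by rw [Set.ncard_coe_finset]; omega) hX
    rw [← this]
    exact fun e he => (Finset.mem_filter.1 he).1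
  · have h3 : #{e ∈ F | e ∈ G.outEdges Xᶜ} = 0 := by omega
    rw [Finset.card_eq_zero, Finset.filter_eq_empty_iff] at h3
    exact fun e he => h3 he

theorem IsFlow.ncard_eq {S : Finset J} {F : Finset E} (h : G.IsFlow b f S F) {X : Set V}
    (hb : b ∉ X) (h1 : G.outEdges X ⊆ ↑F) (h2 : ∀ e ∈ F, e ∉ G.outEdges Xᶜ) :
    (G.outEdges X).ncard = #{s ∈ S | f s ∈ X} := by
  have h3 := h.card_eq hb
  rw [Finset.filter_false_of_mem h2, Finset.card_empty, add_zero] at h3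
  rw [← h3, ← Set.ncard_coe_finset]
  congr 1
  ext e
  simpa using fun he => h1 he

/-- The residual graph of `F`: the edges in `F` are reversed. -/
noncomputable def residual (G : MultiDigraph V E) (F : Finset E) : MultiDigraph V E where
  init e := if e ∈ F then G.ter e else G.init e
  ter e := if e ∈ F then G.init e else G.ter e

theorem IsWalk.residual_congr {F F' : Finset E} {es : List E} {u v : V}
    (h : (G.residual F).IsWalk u es v) (hF : ∀ e ∈ es, (e ∈ F ↔ e ∈ F')) :
    (G.residual F').IsWalk u es v := by
  induction es generalizing u with
  | nil => exact h
  | cons e es ih =>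
    have he := hF e List.mem_cons_self
    have h1 : (G.residual F').init e = (G.residual F).init e := by simp [residual, he]
    have h2 : (G.residual F').ter e = (G.residual F).ter e := by simp [residual, he]
    refine ⟨h1 ▸ h.1, ?_⟩
    rw [h2]
    exact ih h.2 fun x hx => hF x (List.mem_cons_of_mem _ hx)

/-- Toggle the edges of the walk one by one: erasing a reversed edge or inserting a forward one adds
the potential drop along it. As no edge recurs, the rest of the walk is unaffected. -/
theorem IsWalk.exists_augment {F : Finset E} {es : List E} {u v : V}
    (h : (G.residual F).IsWalk u es v) (hn : es.Nodup) :
    ∃ F' : Finset E, ∀ φ : V → ℤ, ∑ e ∈ F', (φ (G.init e) - φ (G.ter e)) =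
      ∑ e ∈ F, (φ (G.init e) - φ (G.ter e)) + (φ u - φ v) := by
  induction es generalizing u F with
  | nil => exact ⟨F, fun φ => by simp [show u = v from h]⟩
  | cons e es ih =>
    obtain ⟨he, hn⟩ := List.nodup_cons.1 hn
    obtain ⟨rfl, h⟩ := h
    by_cases heF : e ∈ F
    · obtain ⟨F', hF'⟩ := ih (F := F.erase e) (h.residual_congr fun x hx => by
        have : x ≠ e := fun hxe => he (hxe ▸ hx)
        simp [this]) hn
      refine ⟨F', fun φ => ?_⟩
      rw [hF', ← Finset.add_sum_erase F _ heF]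
      simp only [residual, heF, if_true]
      ring
    · obtain ⟨F', hF'⟩ := ih (F := insert e F) (h.residual_congr fun x hx => by
        have : x ≠ e := fun hxe => he (hxe ▸ hx)
        simp [this]) hn
      refine ⟨F', fun φ => ?_⟩
      rw [hF', Finset.sum_insert heF]
      simp only [residual, heF, if_false]
      ring

/-- Menger's theorem for flows from a finite family of sources, in an arbitrary digraph. -/
theorem exists_isFlow (S : Finset J)
    (hS : ∀ X : Set V, b ∉ X → (G.outEdges X).Finite →
      #{s ∈ S | f s ∈ X} ≤ (G.outEdges X).ncard) :
    ∃ F, G.IsFlow b f S F := by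
  induction S using Finset.induction_on with
  | empty => exact ⟨∅, fun φ => by simp⟩
  | insert j S hj ih =>
    obtain ⟨F, hF⟩ := ih fun X hb hX =>
      (Finset.card_le_card (Finset.filter_subset_filter _ (Finset.subset_insert _ _))).trans
        (hS X hb hX)
    set X := (G.residual F).reachable (fun _ => True) {f j}
    have hjX : f j ∈ X := subset_reachable _ _ rfl
    by_cases hb : b ∈ X
    · obtain ⟨u, rfl, es, hw, -⟩ := hb
      obtain ⟨P, hPf, hPl, -⟩ := hw.exists_diPath
      have hP := P.isWalk
      rw [hPf, hPl] at hP
      obtain ⟨F', hF'⟩ := hP.exists_augment P.nodup_edges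
      refine ⟨F', fun φ => ?_⟩
      rw [hF', hF φ, Finset.sum_insert hj]
      ring
    -- The reachable set is saturated and not entered, so it has exactly as many outgoing edges as
    -- sources from `S`, leaving no room for `j`.
    · exfalso
      have h1 : G.outEdges X ⊆ ↑F := by
        intro e he
        by_contra heF
        have heF : e ∉ F := heF
        refine he.2 ?_
        have := ter_mem_reachable (G := G.residual F) (p := fun _ => True) (R := {f j}) (e := e)
        simp only [residual, heF, if_false] at this
        exact this he.1 trivial
      have h2 : ∀ e ∈ F, e ∉ G.outEdges Xᶜ := by
        intro e heF he
        refine he.1 ?_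
        have := ter_mem_reachable (G := G.residual F) (p := fun _ => True) (R := {f j}) (e := e)
        simp only [residual, heF, if_true] at this
        exact this (not_not.1 he.2) trivial
      have h3 := hF.ncard_eq hb h1 h2
      have h4 := hS X hb (F.finite_toSet.subset h1)
      rw [Finset.filter_insert, if_pos hjX, Finset.card_insert_of_notMem (by simp [hj])] at h4
      omega

/-- Move one source not at `b` along an edge of `F` and delete that edge. Cycles left over once all
sources have arrived at `b` are ignored. -/
theorem IsFlow.exists_walks {S : Finset J} {F : Finset E} (h : G.IsFlow b f S F) :
    ∃ W : J → List E, (∀ s ∈ S, G.IsWalk (f s) (W s) b ∧ ∀ e ∈ W s, e ∈ F) ∧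
      ∀ s ∈ S, ∀ s' ∈ S, s ≠ s' → ∀ e ∈ W s, e ∉ W s' := by
  induction hn : #F generalizing f F with
  | zero =>
    obtain rfl := Finset.card_eq_zero.1 hn
    refine ⟨fun _ => [], fun s hs => ⟨?_, by simp⟩, by simp⟩
    -- This potential counts the sources away from `b`.
    have := h (fun v => if v = b then 0 else 1)
    simp only [Finset.sum_empty, if_true, sub_zero] at this
    have h2 := (Finset.sum_eq_zero_iff_of_nonneg (fun s _ => by split_ifs <;> simp)).1 this.symm s hs
    by_contra hne
    have hne : f s ≠ b := hne
    simp [hne] at h2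
  | succ n ih =>
    by_cases hb : ∀ s ∈ S, f s = b
    · exact ⟨fun _ => [], fun s hs => ⟨hb s hs, by simp⟩, by simp⟩
    push Not at hb
    obtain ⟨s, hs, hsb⟩ := hb
    obtain ⟨X, hX⟩ : ∃ X : Set V, X = {f s} := ⟨_, rfl⟩
    have h1 := h.card_eq (X := X) (by rw [hX]; exact fun hb => hsb hb.symm)
    have h2 : 0 < #{t ∈ S | f t ∈ X} := Finset.card_pos.2 ⟨s, by simp [hs, hX]⟩
    obtain ⟨e, he⟩ := Finset.card_pos.1 (show 0 < #{e ∈ F | e ∈ G.outEdges X} by omega)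
    obtain ⟨heF, hes, -⟩ := Finset.mem_filter.1 he
    rw [hX] at hes
    have hes : G.init e = f s := hes
    obtain ⟨W, hW, hd⟩ := ih (f := Function.update f s (G.ter e)) (F := F.erase e) (by
      intro φ
      have := h φ
      rw [← Finset.add_sum_erase F _ heF, ← Finset.add_sum_erase S _ hs] at this
      rw [← Finset.add_sum_erase S _ hs, Finset.sum_congr rfl
        (g := fun t => φ (f t) - φ b) fun t ht => by
          rw [Function.update_of_ne (Finset.ne_of_mem_erase ht)]]
      rw [Function.update_self]
      rw [hes] at this
      linarith) (by rw [Finset.card_erase_of_mem heF]; omega)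
    have hnot : ∀ t ∈ S, e ∉ W t := fun t ht het =>
      Finset.notMem_erase e F ((hW t ht).2 e het)
    refine ⟨Function.update W s (e :: W s), fun t ht => ?_, fun t ht t' ht' hne x hx hx' => ?_⟩
    · by_cases hts : t = s
      · subst hts
        have := hW t ht
        rw [Function.update_self] at this
        rw [Function.update_self]
        refine ⟨⟨hes, this.1⟩, fun x hx => ?_⟩
        rcases List.mem_cons.1 hx with rfl | hx
        · exact heF
        · exact Finset.mem_of_mem_erase (this.2 x hx)
      · have := hW t ht
        rw [Function.update_of_ne hts] at this ⊢
        exact ⟨this.1, fun x hx => Finset.mem_of_mem_erase (this.2 x hx)⟩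
    · by_cases hts : t = s
      · subst hts
        rw [Function.update_self] at hx
        rw [Function.update_of_ne hne.symm] at hx'
        rcases List.mem_cons.1 hx with rfl | hx
        · exact hnot t' ht' hx'
        · exact hd t ht t' ht' hne x hx hx'
      · rw [Function.update_of_ne hts] at hx
        by_cases hts' : t' = s
        · subst hts'
          rw [Function.update_self] at hx'
          rcases List.mem_cons.1 hx' with rfl | hx'
          · exact hnot t ht hx
          · exact hd t ht t' ht' hne x hx hx'
        · rw [Function.update_of_ne hts'] at hx'
          exact hd t ht t' ht' hne x hx hx'

/-- A linkage to `b` of the sources `f s`, for `s` in a finite set `S`. -/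
structure IsLinked (b : V) (f : J → V) (S : Finset J) (P : J → G.DiPath) : Prop where
  first_eq : ∀ s ∈ S, (P s).first = f s
  last_eq : ∀ s ∈ S, (P s).last = b
  disjoint : ∀ s ∈ S, ∀ s' ∈ S, s ≠ s' → Disjoint (P s).edgeSet (P s').edgeSet

theorem IsFlow.exists_isLinked {S : Finset J} {F : Finset E} (h : G.IsFlow b f S F) :
    ∃ P : J → G.DiPath, IsLinked b f S P := by
  obtain ⟨W, hW, hd⟩ := h.exists_walks
  have : ∀ s, ∃ P : G.DiPath, s ∈ S → P.first = f s ∧ P.last = b ∧ P.edges ⊆ W s := by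
    intro s
    by_cases hs : s ∈ S
    · obtain ⟨P, hP⟩ := (hW s hs).1.exists_diPath
      exact ⟨P, fun _ => hP⟩
    · exact ⟨⟨b, [], b, rfl, by simp⟩, fun h => absurd h hs⟩
  choose P hP using this
  refine ⟨P, fun s hs => (hP s hs).1, fun s hs => (hP s hs).2.1, fun s hs s' hs' hne => ?_⟩
  rw [Set.disjoint_left]
  exact fun e he he' => hd s hs s' hs' hne e ((hP s hs).2.2 he) ((hP s' hs').2.2 he')

/-- The edges of a linkage form a flow. -/
theorem IsLinked.isFlow {S : Finset J} {P : J → G.DiPath} (h : IsLinked b f S P) :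
    G.IsFlow b f S (S.biUnion fun s => (P s).edges.toFinset) := by
  intro φ
  rw [Finset.sum_biUnion]
  · refine Finset.sum_congr rfl fun s hs => ?_
    rw [List.sum_toFinset _ (P s).nodup_edges, (P s).isWalk.sum_sub, h.first_eq s hs,
      h.last_eq s hs]
  · intro s hs s' hs' hne
    rw [Function.onFun, Finset.disjoint_left]
    intro e he he'
    exact Set.disjoint_left.1 (h.disjoint s hs s' hs' hne) (List.mem_toFinset.1 he)
      (List.mem_toFinset.1 he')

end Flows

/-! ### Tight sets, their hulls and maximal source sets -/

section Tight

open Classical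

variable {V E J : Type*} {G : MultiDigraph V E} {b : V} {f : J → V} {A : Set J} {X Y : Set V}

/-- The cut condition for linking the sources `f j`, `j ∈ A`, to `b`. -/
def CutCondition (G : MultiDigraph V E) (b : V) (f : J → V) (A : Set J) : Prop :=
  ∀ X : Set V, b ∉ X → (G.outEdges X).Finite → (A ∩ f ⁻¹' X).encard ≤ (G.outEdges X).encard

/-- A set of vertices for which the cut condition holds with equality. -/
structure Tight (G : MultiDigraph V E) (b : V) (f : J → V) (A : Set J) (X : Set V) : Prop where
  notMem : b ∉ X
  finite : (G.outEdges X).Finite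
  le : (G.outEdges X).encard ≤ (A ∩ f ⁻¹' X).encard

theorem coe_filter_mem (S : Finset J) (X : Set V) :
    (({s ∈ S | f s ∈ X} : Finset J) : Set J) = ↑S ∩ f ⁻¹' X := by
  ext s; simp

theorem CutCondition.exists_isFlow (hA : G.CutCondition b f A) {S : Finset J} (hS : ↑S ⊆ A) :
    ∃ F, G.IsFlow b f S F := by
  refine MultiDigraph.exists_isFlow S fun X hb hX => ?_
  have h1 := (Set.encard_le_encard (Set.inter_subset_inter_left (f ⁻¹' X) hS)).trans (hA X hb hX)
  rw [← coe_filter_mem, Set.encard_coe_eq_coe_finsetCard, ← hX.cast_ncard_eq] at h1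
  exact_mod_cast h1

theorem CutCondition.finite_inter (hA : G.CutCondition b f A) (hb : b ∉ X)
    (hX : (G.outEdges X).Finite) : (A ∩ f ⁻¹' X).Finite :=
  Set.encard_lt_top_iff.1 ((hA X hb hX).trans_lt hX.encard_lt_top)

theorem Tight.finite_inter (hX : G.Tight b f A X) (hA : G.CutCondition b f A) :
    (A ∩ f ⁻¹' X).Finite :=
  hA.finite_inter hX.notMem hX.finite

theorem Tight.saturates (hX : G.Tight b f A X) {S : Finset J} (hS : A ∩ f ⁻¹' X ⊆ ↑S)
    {F : Finset E} (hF : G.IsFlow b f S F) :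
    G.outEdges X ⊆ ↑F ∧ ∀ e ∈ F, e ∉ G.outEdges Xᶜ := by
  refine hF.saturates hX.notMem hX.finite ?_
  have h1 := hX.le.trans (Set.encard_le_encard (Set.subset_inter hS Set.inter_subset_right))
  rw [← coe_filter_mem, Set.encard_coe_eq_coe_finsetCard, ← hX.finite.cast_ncard_eq] at h1
  exact_mod_cast h1

/-- Converse to `Tight.saturates`; together they reduce closure properties of tight sets to checking
edges of one flow. -/
theorem IsFlow.tight {S : Finset J} (hS : ↑S ⊆ A) {F : Finset E} (hF : G.IsFlow b f S F)
    (hb : b ∉ X) (h1 : G.outEdges X ⊆ ↑F) (h2 : ∀ e ∈ F, e ∉ G.outEdges Xᶜ) :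
    G.Tight b f A X := by
  have hX := F.finite_toSet.subset h1
  refine ⟨hb, hX, ?_⟩
  rw [← hX.cast_ncard_eq, hF.ncard_eq hb h1 h2, ← Set.encard_coe_eq_coe_finsetCard,
    coe_filter_mem]
  exact Set.encard_le_encard (Set.inter_subset_inter_left _ hS)

/-- Two tight sets are saturated by a common flow. -/
theorem Tight.exists_common_flow (hA : G.CutCondition b f A) (hX : G.Tight b f A X)
    (hY : G.Tight b f A Y) : ∃ (S : Finset J) (F : Finset E), ↑S ⊆ A ∧ G.IsFlow b f S F ∧
      (G.outEdges X ⊆ ↑F ∧ ∀ e ∈ F, e ∉ G.outEdges Xᶜ) ∧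
      (G.outEdges Y ⊆ ↑F ∧ ∀ e ∈ F, e ∉ G.outEdges Yᶜ) := by
  have hfin := (hX.finite_inter hA).union (hY.finite_inter hA)
  have hS : ↑hfin.toFinset ⊆ A := by
    rw [hfin.coe_toFinset]
    exact Set.union_subset Set.inter_subset_left Set.inter_subset_left
  obtain ⟨F, hF⟩ := hA.exists_isFlow hS
  exact ⟨_, F, hS, hF, hX.saturates (by simp) hF, hY.saturates (by simp) hF⟩

/-- An edge leaving (entering) the union leaves (enters) one of the two sets, so a common flow
saturates the union as well. Intersections behave alike. -/
theorem Tight.union (hA : G.CutCondition b f A) (hX : G.Tight b f A X) (hY : G.Tight b f A Y) :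
    G.Tight b f A (X ∪ Y) := by
  obtain ⟨S, F, hS, hF, ⟨hX1, hX2⟩, hY1, hY2⟩ := hX.exists_common_flow hA hY
  refine hF.tight hS (fun h => h.elim hX.notMem hY.notMem) ?_ ?_
  · rintro e ⟨h | h, h'⟩
    · exact hX1 ⟨h, fun h => h' (Or.inl h)⟩
    · exact hY1 ⟨h, fun h => h' (Or.inr h)⟩
  · rintro e he ⟨h, h'⟩
    rcases not_not.1 h' with h' | h'
    · exact hX2 e he ⟨fun h1 => h (Or.inl h1), not_not.2 h'⟩
    · exact hY2 e he ⟨fun h1 => h (Or.inr h1), not_not.2 h'⟩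

theorem Tight.inter (hA : G.CutCondition b f A) (hX : G.Tight b f A X) (hY : G.Tight b f A Y) :
    G.Tight b f A (X ∩ Y) := by
  obtain ⟨S, F, hS, hF, ⟨hX1, hX2⟩, hY1, hY2⟩ := hX.exists_common_flow hA hY
  refine hF.tight hS (fun h => hX.notMem h.1) ?_ ?_
  · rintro e ⟨h, h'⟩
    by_cases hX' : G.ter e ∈ X
    · exact hY1 ⟨h.2, fun hY' => h' ⟨hX', hY'⟩⟩
    · exact hX1 ⟨h.1, hX'⟩
  · rintro e he ⟨h, h'⟩
    have h' := not_not.1 h'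
    by_cases hX' : G.init e ∈ X
    · exact hY2 e he ⟨fun hY' => h ⟨hX', hY'⟩, not_not.2 h'.2⟩
    · exact hX2 e he ⟨hX', not_not.2 h'.1⟩

/-- No edge leaving a tight set enters another tight set. -/
theorem Tight.init_mem (hA : G.CutCondition b f A) (hX : G.Tight b f A X)
    (hY : G.Tight b f A Y) {e : E} (he : e ∈ G.outEdges X) (heY : G.ter e ∈ Y) :
    G.init e ∈ Y := by
  obtain ⟨S, F, hS, hF, ⟨hX1, hX2⟩, hY1, hY2⟩ := hX.exists_common_flow hA hY
  by_contra h
  exact hY2 e (hX1 he) ⟨h, not_not.2 heY⟩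

theorem tight_empty : G.Tight b f A ∅ := by
  have : G.outEdges (∅ : Set V) = ∅ := by ext; simp [outEdges]
  exact ⟨id, by simp [this], by simp [this]⟩

/-- A subset of a tight set that agrees on each finite set with some tight set is tight. -/
theorem Tight.of_approx (hA : G.CutCondition b f A) (hX : G.Tight b f A X) (hYX : Y ⊆ X)
    (h : ∀ W : Set V, W.Finite → ∃ Z, G.Tight b f A Z ∧ ∀ w ∈ W, (w ∈ Z ↔ w ∈ Y)) :
    G.Tight b f A Y := by
  have hfin : (A ∩ f ⁻¹' Y).Finite := (hX.finite_inter hA).subset fun j hj => ⟨hj.1, hYX hj.2⟩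
  have key : (G.outEdges Y).encard ≤ (A ∩ f ⁻¹' Y).encard := by
    by_contra! hlt
    -- A failure is witnessed by finitely many edges leaving `Y`, one more than its sources.
    obtain ⟨t, ht, htc⟩ := Set.exists_subset_encard_eq (Order.add_one_le_of_lt hlt)
    have htf : t.Finite := by
      rw [← Set.encard_lt_top_iff, htc, ENat.add_lt_top]
      exact ⟨hfin.encard_lt_top, by simp⟩
    have hXf := hX.finite_inter hA
    obtain ⟨Z, hZ, hW⟩ := h (G.init '' t ∪ G.ter '' t ∪ f '' (A ∩ f ⁻¹' X))
      (((htf.image _).union (htf.image _)).union (hXf.image _))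
    obtain ⟨Z, hZX, hZ, hW⟩ : ∃ Z ⊆ X, G.Tight b f A Z ∧
        ∀ w ∈ (G.init '' t ∪ G.ter '' t ∪ f '' (A ∩ f ⁻¹' X)), (w ∈ Z ↔ w ∈ Y) := by
      -- Agreement with `Y` is only known at sources in `X`, so those outside must be cut off.
      refine ⟨Z ∩ X, Set.inter_subset_right, hZ.inter hA hX, fun w hw => ?_⟩
      rw [Set.mem_inter_iff, hW w hw]
      exact ⟨And.left, fun h => ⟨h, hYX h⟩⟩
    have h1 : t ⊆ G.outEdges Z := fun e he =>
      ⟨(hW _ (Or.inl (Or.inl ⟨e, he, rfl⟩))).2 (ht he).1,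
        fun h => (ht he).2 ((hW _ (Or.inl (Or.inr ⟨e, he, rfl⟩))).1 h)⟩
    have h2 : A ∩ f ⁻¹' Z ⊆ A ∩ f ⁻¹' Y := fun j hj =>
      ⟨hj.1, (hW _ (Or.inr ⟨j, ⟨hj.1, hZX hj.2⟩, rfl⟩)).1 hj.2⟩
    have h3 := (Set.encard_le_encard h1).trans (hZ.le.trans (Set.encard_le_encard h2))
    rw [htc, ← hfin.cast_ncard_eq] at h3
    have h3 : (A ∩ f ⁻¹' Y).ncard + 1 ≤ (A ∩ f ⁻¹' Y).ncard := by exact_mod_cast h3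
    omega
  exact ⟨fun hb => hX.notMem (hYX hb),
    Set.encard_lt_top_iff.1 (key.trans_lt hfin.encard_lt_top), key⟩

/-- The intersection of all tight sets containing `v`. -/
def tightHull (G : MultiDigraph V E) (b : V) (f : J → V) (A : Set J) (v : V) : Set V :=
  {w | ∀ X, G.Tight b f A X → v ∈ X → w ∈ X}

theorem mem_tightHull (v : V) : v ∈ G.tightHull b f A v := fun _ _ h => h

theorem tightHull_subset (hX : G.Tight b f A X) {v : V} (hv : v ∈ X) :
    G.tightHull b f A v ⊆ X := fun _ hw => hw X hX hv

/-- On a finite set the hull agrees with a finite intersection of tight sets, one excluding each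
point outside the hull. -/
theorem tight_tightHull (hA : G.CutCondition b f A) (hX : G.Tight b f A X) {v : V}
    (hv : v ∈ X) : G.Tight b f A (G.tightHull b f A v) := by
  refine hX.of_approx hA (tightHull_subset hX hv) fun W hW => ?_
  suffices ∃ Z, G.Tight b f A Z ∧ v ∈ Z ∧ ∀ w ∈ W, w ∈ Z → w ∈ G.tightHull b f A v by
    obtain ⟨Z, hZ, hvZ, h⟩ := this
    exact ⟨Z, hZ, fun w hw => ⟨h w hw, fun h => h Z hZ hvZ⟩⟩
  induction W, hW using Set.Finite.induction_on with
  | empty => exact ⟨X, hX, hv, by simp⟩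
  | @insert a W _ _ ih =>
    obtain ⟨Z, hZ, hvZ, h⟩ := ih
    by_cases ha : a ∈ G.tightHull b f A v
    · refine ⟨Z, hZ, hvZ, ?_⟩
      rintro w (rfl | hw) hwZ
      · exact ha
      · exact h w hw hwZ
    · have : ∃ Z', G.Tight b f A Z' ∧ v ∈ Z' ∧ a ∉ Z' := by
        by_contra! hcon
        exact ha fun Z' h1 h2 => hcon Z' h1 h2
      obtain ⟨Z', hZ', hvZ', haZ'⟩ := this
      refine ⟨Z ∩ Z', hZ.inter hA hZ', ⟨hvZ, hvZ'⟩, ?_⟩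
      rintro w (rfl | hw) hwZ
      · exact absurd hwZ.2 haZ'
      · exact h w hw hwZ.1

theorem exists_index_of_finite {T : ℕ → Set V} (hm : Monotone T) {W : Set V} (hW : W.Finite) :
    ∃ n, ∀ w ∈ W, w ∈ ⋃ n, T n → w ∈ T n := by
  induction W, hW using Set.Finite.induction_on with
  | empty => exact ⟨0, by simp⟩
  | @insert a W _ _ ih =>
    obtain ⟨n, hn⟩ := ih
    by_cases ha : a ∈ ⋃ n, T n
    · obtain ⟨m, hm'⟩ := Set.mem_iUnion.1 ha
      refine ⟨max n m, ?_⟩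
      rintro w (rfl | hw) hwT
      · exact hm (le_max_right _ _) hm'
      · exact hm (le_max_left _ _) (hn w hw hwT)
    · refine ⟨n, ?_⟩
      rintro w (rfl | hw) hwT
      · exact absurd hwT ha
      · exact hn w hw hwT

theorem Tight.iUnion_nat (hA : G.CutCondition b f A) (hX : G.Tight b f A X) {T : ℕ → Set V}
    (hT : ∀ n, G.Tight b f A (T n)) (hm : Monotone T) (hTX : ∀ n, T n ⊆ X) :
    G.Tight b f A (⋃ n, T n) := by
  refine hX.of_approx hA (Set.iUnion_subset hTX) fun W hW => ?_
  suffices ∃ n, ∀ w ∈ W, w ∈ ⋃ n, T n → w ∈ T n by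
    obtain ⟨n, hn⟩ := this
    exact ⟨T n, hT n, fun w hw => ⟨fun h => Set.mem_iUnion.2 ⟨n, h⟩, hn w hw⟩⟩
  exact exists_index_of_finite hm hW

/-- If the tight sets cover all sets with finitely many outgoing edges, then each such set lies
in a single tight set. -/
theorem exists_tight_superset (hA : G.CutCondition b f A)
    (hcov : ∀ X, b ∉ X → (G.outEdges X).Finite → ∀ v ∈ X, ∃ T, G.Tight b f A T ∧ v ∈ T)
    (hb : b ∉ X) (hX : (G.outEdges X).Finite) : ∃ T, G.Tight b f A T ∧ X ⊆ T := by
  have : ∀ W : Set V, W.Finite → W ⊆ X → ∃ T, G.Tight b f A T ∧ W ⊆ T := by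
    intro W hW
    induction W, hW using Set.Finite.induction_on with
    | empty => exact fun _ => ⟨∅, tight_empty, subset_rfl⟩
    | @insert a W _ _ ih =>
      intro hWX
      obtain ⟨haX, hWX⟩ := Set.insert_subset_iff.1 hWX
      obtain ⟨T, hT, hWT⟩ := ih hWX
      obtain ⟨T', hT', haT'⟩ := hcov X hb hX a haX
      exact ⟨T ∪ T', hT.union hA hT', Set.insert_subset (Or.inr haT')
        (hWT.trans Set.subset_union_left)⟩
  -- It suffices to cover the finitely many tails of edges leaving `X`: then every edge leaving `T ∪
  -- X` leaves `T`.
  obtain ⟨T, hT, hXT⟩ := this (G.init '' G.outEdges X) (hX.image _)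
    (by rintro _ ⟨e, he, rfl⟩; exact he.1)
  have hsub : G.outEdges (T ∪ X) ⊆ G.outEdges T := by
    rintro e ⟨h | h, h'⟩
    · exact ⟨h, fun h => h' (Or.inl h)⟩
    · exact ⟨hXT ⟨e, ⟨h, fun h => h' (Or.inr h)⟩, rfl⟩, fun h => h' (Or.inl h)⟩
  refine ⟨T ∪ X, ⟨fun h => h.elim hT.notMem hb, hT.finite.subset hsub, ?_⟩,
    Set.subset_union_right⟩
  refine (Set.encard_le_encard hsub).trans (hT.le.trans (Set.encard_le_encard ?_))
  exact fun j hj => ⟨hj.1, Or.inl hj.2⟩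

/-- The cut condition is of finite character. -/
theorem CutCondition.exists_maximal (hA : G.CutCondition b f A) :
    ∃ M, A ⊆ M ∧ G.CutCondition b f M ∧ ∀ j ∉ M, ¬ G.CutCondition b f (insert j M) := by
  obtain ⟨M, hAM, hM⟩ := zorn_subset_nonempty {M | G.CutCondition b f M} (by
    intro c hc hchain hne
    refine ⟨⋃₀ c, fun X hb hX => ?_, fun s hs => Set.subset_sUnion_of_mem hs⟩
    by_contra! hlt
    -- A violation needs only finitely many sources, which lie in one member of the chain.
    obtain ⟨t, ht, htc⟩ := Set.exists_subset_encard_eq (Order.add_one_le_of_lt hlt)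
    have htf : t.Finite := by
      rw [← Set.encard_lt_top_iff, htc, ENat.add_lt_top]
      exact ⟨hX.encard_lt_top, by simp⟩
    obtain ⟨M, hMc, htM⟩ := DirectedOn.exists_mem_subset_of_finite_of_subset_sUnion hne
      hchain.directedOn htf (fun j hj => (ht hj).1)
    have h1 := (Set.encard_le_encard (Set.subset_inter htM fun j hj => (ht hj).2)).trans
      (hc hMc X hb hX)
    rw [htc, ← hX.cast_ncard_eq] at h1
    have h1 : (G.outEdges X).ncard + 1 ≤ (G.outEdges X).ncard := by exact_mod_cast h1
    omega) A hA
  refine ⟨M, hAM, hM.prop, fun j hj hins => hj ?_⟩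
  exact hM.le_of_ge hins (Set.subset_insert _ _) (Set.mem_insert _ _)

/-- With infinitely many sources at every vertex available, a maximal set of sources satisfying
the cut condition has a tight set around every vertex that can be separated from `b`. -/
theorem exists_tight_of_maximal {M : Set (V × ℕ)} (hM : G.CutCondition b Prod.fst M)
    (hmax : ∀ j ∉ M, ¬ G.CutCondition b Prod.fst (insert j M)) {X : Set V} (hb : b ∉ X)
    (hX : (G.outEdges X).Finite) {v : V} (hv : v ∈ X) :
    ∃ T, G.Tight b Prod.fst M T ∧ v ∈ T := by
  obtain ⟨n, hn⟩ : ∃ n : ℕ, (v, n) ∉ M := by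
    -- Only finitely many sources of `M` lie in `X`, so not all copies of `v` are used.
    by_contra! hcon
    refine Set.infinite_range_of_injective (f := fun n : ℕ => (v, n))
      (fun n m h => (Prod.mk.inj h).2) ((hM.finite_inter hb hX).subset ?_)
    rintro _ ⟨n, rfl⟩
    exact ⟨hcon n, hv⟩
  have := hmax _ hn
  unfold CutCondition at this
  push Not at this
  obtain ⟨Y, hbY, hY, hlt⟩ := this
  have hvY : v ∈ Y := by
    by_contra hvY
    refine absurd (hM Y hbY hY) (not_le.2 ?_)
    convert hlt using 2
    ext j
    simp only [Set.mem_inter_iff, Set.mem_insert_iff, Set.mem_preimage]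
    refine ⟨fun h => ⟨Or.inr h.1, h.2⟩, ?_⟩
    rintro ⟨rfl | h, h'⟩
    · exact absurd h' hvY
    · exact ⟨h, h'⟩
  refine ⟨Y, ⟨hbY, hY, ?_⟩, hvY⟩
  rw [Set.insert_inter_of_mem (by exact hvY)] at hlt
  rw [Set.encard_insert_of_notMem fun h => hn h.1] at hlt
  exact (ENat.lt_add_one_iff' hY.encard_lt_top.ne).1 hlt

end Tight

/-! ### Trails through the linkages of growing hulls -/

section Trails

open Classical

variable {V E J : Type*} {G : MultiDigraph V E} {b : V} {f : J → V} {A : Set J} {T : Set V}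

theorem IsWalk.getElem?_length {es : List E} {u v : V} (h : G.IsWalk u es v) :
    (u :: es.map G.ter)[es.length]? = some v := by
  induction es generalizing u with
  | nil => simp [show u = v from h]
  | cons e es ih => simpa using ih h.2

theorem IsWalk.getElem?_init {es : List E} {u v : V} (h : G.IsWalk u es v) {k : ℕ} {e : E}
    (he : es[k]? = some e) : (u :: es.map G.ter)[k]? = some (G.init e) := by
  induction es generalizing u k with
  | nil => simp at he
  | cons e' es ih =>
    cases k with
    | zero =>
      obtain rfl : e' = e := by simpa using he
      simp [h.1]
    | succ k => simpa using ih h.2 (by simpa using he)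

/-- A linkage of the sources in `T` to `b` that respects all tight subsets of `T`: it uses all edges
leaving such a subset and no edge entering it. -/
structure IsTightLinkage (b : V) (f : J → V) (A : Set J) (T : Set V) (P : J → G.DiPath) :
    Prop where
  first_eq : ∀ j ∈ A ∩ f ⁻¹' T, (P j).first = f j
  last_eq : ∀ j ∈ A ∩ f ⁻¹' T, (P j).last = b
  disjoint : ∀ j ∈ A ∩ f ⁻¹' T, ∀ j' ∈ A ∩ f ⁻¹' T, j ≠ j' →
    Disjoint (P j).edgeSet (P j').edgeSet
  not_enter : ∀ Y, G.Tight b f A Y → Y ⊆ T → ∀ j ∈ A ∩ f ⁻¹' T, ∀ e ∈ (P j).edges,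
    e ∉ G.outEdges Yᶜ
  saturates : ∀ Y, G.Tight b f A Y → Y ⊆ T → ∀ e ∈ G.outEdges Y,
    ∃ j ∈ A ∩ f ⁻¹' T, e ∈ (P j).edges

/-- One flow from all sources in `T` serves all tight subsets at once, as it routes all of their
sources. -/
theorem Tight.exists_isTightLinkage (hA : G.CutCondition b f A) (hT : G.Tight b f A T) :
    ∃ P : J → G.DiPath, IsTightLinkage b f A T P := by
  have hfin := hT.finite_inter hA
  obtain ⟨F, hF⟩ := hA.exists_isFlow (S := hfin.toFinset) (by simp)
  obtain ⟨P, hP⟩ := hF.exists_isLinked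
  have hsat : ∀ Y, G.Tight b f A Y → Y ⊆ T → _ := fun Y hY hYT =>
    hY.saturates (S := hfin.toFinset)
      (by rw [hfin.coe_toFinset]; exact fun j hj => ⟨hj.1, hYT hj.2⟩) hP.isFlow
  refine ⟨P, fun j hj => hP.first_eq j (by simpa using hj),
    fun j hj => hP.last_eq j (by simpa using hj),
    fun j hj j' hj' => hP.disjoint j (by simpa using hj) j' (by simpa using hj'), ?_, ?_⟩
  · intro Y hY hYT j hj e he
    exact (hsat Y hY hYT).2 e
      (Finset.mem_biUnion.2 ⟨j, hfin.mem_toFinset.2 hj, List.mem_toFinset.2 he⟩)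
  · intro Y hY hYT e he
    obtain ⟨j, hj, hje⟩ := Finset.mem_biUnion.1 ((hsat Y hY hYT).1 he)
    exact ⟨j, hfin.mem_toFinset.1 hj, List.mem_toFinset.1 hje⟩

/-- The vertex reached by a source or an edge. -/
def head (G : MultiDigraph V E) (f : J → V) : J ⊕ E → V := Sum.elim f G.ter

/-- The sequence consisting of the source `j` followed by the edges of the path `P`. -/
def tokens (j : J) (P : G.DiPath) : List (J ⊕ E) := Sum.inl j :: P.edges.map Sum.inr

/-- `t'` directly follows `t` on one of the paths of a linkage of `T`. -/
def Follows (f : J → V) (A : Set J) (T : Set V) (P : J → G.DiPath) (t t' : J ⊕ E) : Prop :=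
  ∃ j ∈ A ∩ f ⁻¹' T, ∃ k, (tokens j (P j))[k]? = some t ∧ (tokens j (P j))[k + 1]? = some t'

theorem IsTightLinkage.map_head {P : J → G.DiPath} (hP : IsTightLinkage b f A T P) {j : J}
    (hj : j ∈ A ∩ f ⁻¹' T) :
    (tokens j (P j)).map (G.head f) = (P j).first :: (P j).edges.map G.ter := by
  simp [tokens, head, hP.first_eq j hj]

theorem IsTightLinkage.nodup_map_head {P : J → G.DiPath} (hP : IsTightLinkage b f A T P) {j : J}
    (hj : j ∈ A ∩ f ⁻¹' T) : ((tokens j (P j)).map (G.head f)).Nodup := by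
  rw [hP.map_head hj]
  exact (P j).nodup

theorem IsTightLinkage.source_unique {P : J → G.DiPath} (hP : IsTightLinkage b f A T P)
    {j j' : J} (hj : j ∈ A ∩ f ⁻¹' T) (hj' : j' ∈ A ∩ f ⁻¹' T) {t : J ⊕ E}
    (ht : t ∈ tokens j (P j)) (ht' : t ∈ tokens j' (P j')) : j = j' := by
  by_contra hne
  rcases t with i | e
  · simp only [tokens, List.mem_cons, Sum.inl.injEq, List.mem_map, reduceCtorEq, and_false,
      exists_false, or_false] at ht ht'
    exact hne (ht.symm.trans ht')
  · simp only [tokens, List.mem_cons, reduceCtorEq, List.mem_map, Sum.inr.injEq,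
      exists_eq_right, false_or] at ht ht'
    exact Set.disjoint_left.1 (hP.disjoint j hj j' hj' hne) ht ht'

/-- A token occurs at only one position of a linkage. -/
theorem IsTightLinkage.position_unique {P : J → G.DiPath} (hP : IsTightLinkage b f A T P)
    {j j' : J} (hj : j ∈ A ∩ f ⁻¹' T) (hj' : j' ∈ A ∩ f ⁻¹' T) {t : J ⊕ E} {k k' : ℕ}
    (ht : (tokens j (P j))[k]? = some t) (ht' : (tokens j' (P j'))[k']? = some t) :
    j = j' ∧ k = k' := by
  obtain rfl := hP.source_unique hj hj' (List.mem_of_getElem? ht) (List.mem_of_getElem? ht')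
  refine ⟨rfl, ?_⟩
  have hk : k < (tokens j (P j)).length := by
    obtain ⟨h, -⟩ := List.getElem?_eq_some_iff.1 ht
    exact h
  exact List.getElem?_inj hk (List.Nodup.of_map _ (hP.nodup_map_head hj)) |>.1
    (ht.trans ht'.symm)

theorem IsTightLinkage.left_unique {P : J → G.DiPath} (hP : IsTightLinkage b f A T P)
    {t₁ t₂ t : J ⊕ E} (h₁ : Follows f A T P t₁ t) (h₂ : Follows f A T P t₂ t) : t₁ = t₂ := by
  obtain ⟨j, hj, k, hk, hk1⟩ := h₁
  obtain ⟨j', hj', k', hk', hk1'⟩ := h₂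
  obtain ⟨rfl, h⟩ := hP.position_unique hj hj' hk1 hk1'
  obtain rfl : k = k' := by omega
  exact Option.some.inj (hk.symm.trans hk')

theorem IsTightLinkage.exists_edge {P : J → G.DiPath} (hP : IsTightLinkage b f A T P)
    {t t' : J ⊕ E} (h : Follows f A T P t t') :
    ∃ e, t' = Sum.inr e ∧ G.init e = G.head f t ∧ ∃ j ∈ A ∩ f ⁻¹' T, e ∈ (P j).edges := by
  obtain ⟨j, hj, k, hk, hk1⟩ := h
  rw [tokens, List.getElem?_cons_succ, List.getElem?_map, Option.map_eq_some_iff] at hk1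
  obtain ⟨e, he, rfl⟩ := hk1
  refine ⟨e, rfl, ?_, j, hj, List.mem_of_getElem? he⟩
  have h1 := (P j).isWalk.getElem?_init he
  rw [← hP.map_head hj, List.getElem?_map, hk] at h1
  exact (Option.some.inj h1).symm

theorem IsTightLinkage.exists_follows {P : J → G.DiPath} (hP : IsTightLinkage b f A T P)
    {j : J} (hj : j ∈ A ∩ f ⁻¹' T) {t : J ⊕ E} (ht : t ∈ tokens j (P j))
    (hb : G.head f t ≠ b) : ∃ t', Follows f A T P t t' := by
  obtain ⟨k, hk⟩ := List.mem_iff_getElem?.1 ht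
  rcases h : (tokens j (P j))[k + 1]? with _ | t'
  · exfalso
    have h1 := List.getElem?_eq_none_iff.1 h
    obtain ⟨h2, -⟩ := List.getElem?_eq_some_iff.1 hk
    have h3 : (tokens j (P j)).length = (P j).edges.length + 1 := by simp [tokens]
    obtain rfl : k = (P j).edges.length := by omega
    have h4 := (P j).isWalk.getElem?_length
    rw [← hP.map_head hj, List.getElem?_map, hk, hP.last_eq j hj] at h4
    exact hb (Option.some.inj h4)
  · exact ⟨t', j, hj, k, hk, h⟩

/-- A vertex in some tight set. -/
def Covered (G : MultiDigraph V E) (b : V) (f : J → V) (A : Set J) (v : V) : Prop :=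
  ∃ X, G.Tight b f A X ∧ v ∈ X

theorem Covered.tight (hA : G.CutCondition b f A) {v : V} (h : G.Covered b f A v) :
    G.Tight b f A (G.tightHull b f A v) := by
  obtain ⟨X, hX, hv⟩ := h
  exact tight_tightHull hA hX hv

theorem Covered.ne {v : V} (h : G.Covered b f A v) : v ≠ b := by
  obtain ⟨X, hX, hv⟩ := h
  rintro rfl
  exact hX.notMem hv

/-- The token `t` lies on the linkage chosen for the tight hull of its head. -/
def Good (b : V) (f : J → V) (A : Set J) (L : Set V → J → G.DiPath) (t : J ⊕ E) : Prop :=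
  ∃ j ∈ A ∩ f ⁻¹' G.tightHull b f A (G.head f t),
    t ∈ tokens j (L (G.tightHull b f A (G.head f t)) j)

/-- `t'` follows `t` on the linkage chosen for the tight hull of the head of `t`. -/
def Next (b : V) (f : J → V) (A : Set J) (L : Set V → J → G.DiPath) (t t' : J ⊕ E) : Prop :=
  Follows f A (G.tightHull b f A (G.head f t)) (L (G.tightHull b f A (G.head f t))) t t'

/-- A family of linkages, one for each tight set. -/
def IsLinkageSystem (b : V) (f : J → V) (A : Set J) (L : Set V → J → G.DiPath) : Prop :=
  ∀ T, G.Tight b f A T → IsTightLinkage b f A T (L T)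

variable {L : Set V → J → G.DiPath}

/-- If the edge stays in the hull, the linkage cannot enter the hull of its head from outside, so
both hulls agree. If it leaves, its tail lies in the new hull by `Tight.init_mem`; so the new hull
contains the old, and saturation puts the edge on the new linkage. -/
theorem Next.subset_and_good (hA : G.CutCondition b f A) (hL : IsLinkageSystem b f A L)
    {t t' : J ⊕ E} (ht : G.Covered b f A (G.head f t)) (h : Next b f A L t t')
    (ht' : G.Covered b f A (G.head f t')) :
    G.tightHull b f A (G.head f t) ⊆ G.tightHull b f A (G.head f t') ∧ Good b f A L t' := by
  have hT := ht.tight hA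
  have hT' := ht'.tight hA
  obtain ⟨e, rfl, hinit, j, hj, hje⟩ := (hL _ hT).exists_edge h
  have hmem : G.init e ∈ G.tightHull b f A (G.head f t) := hinit ▸ mem_tightHull _
  by_cases he : G.ter e ∈ G.tightHull b f A (G.head f t)
  · have hsub := tightHull_subset hT he
    have hin : G.init e ∈ G.tightHull b f A (G.ter e) := by
      by_contra hcon
      exact (hL _ hT).not_enter _ hT' hsub j hj e hje
        ⟨hcon, not_not.2 (mem_tightHull _)⟩
    have hsub' : G.tightHull b f A (G.head f t) ⊆ G.tightHull b f A (G.ter e) := by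
      rw [← hinit]
      exact tightHull_subset hT' hin
    refine ⟨hsub', ?_⟩
    have heq : G.tightHull b f A (G.head f (Sum.inr e)) = G.tightHull b f A (G.head f t) :=
      subset_antisymm hsub hsub'
    unfold Good
    rw [heq]
    exact ⟨j, hj, List.mem_cons_of_mem _ (List.mem_map_of_mem hje)⟩
  · have hin := hT.init_mem hA hT' ⟨hmem, he⟩ (mem_tightHull _)
    have hsub' : G.tightHull b f A (G.head f t) ⊆ G.tightHull b f A (G.ter e) := by
      rw [← hinit]
      exact tightHull_subset hT' hin
    obtain ⟨i, hi, hie⟩ := (hL _ hT').saturates _ hT hsub' e ⟨hmem, he⟩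
    exact ⟨hsub', i, hi, List.mem_cons_of_mem _ (List.mem_map_of_mem hie)⟩

/-- An edge determines its tail, hence the hull and the linkage followed, where its predecessor is
unique. -/
theorem Next.left_unique (hA : G.CutCondition b f A) (hL : IsLinkageSystem b f A L)
    {t₁ t₂ t : J ⊕ E} (h₁ : Next b f A L t₁ t) (h₂ : Next b f A L t₂ t)
    (hc₁ : G.Covered b f A (G.head f t₁)) (hc₂ : G.Covered b f A (G.head f t₂)) : t₁ = t₂ := by
  have hT := hc₁.tight hA
  obtain ⟨e, rfl, he, -⟩ := (hL _ hT).exists_edge h₁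
  obtain ⟨e', h, he', -⟩ := (hL _ (hc₂.tight hA)).exists_edge h₂
  obtain rfl := Sum.inr.inj h
  have heq : G.head f t₂ = G.head f t₁ := he'.symm.trans he
  unfold Next at h₂
  rw [heq] at h₂
  exact (hL _ hT).left_unique h₁ h₂

theorem Good.exists_next (hA : G.CutCondition b f A) (hL : IsLinkageSystem b f A L)
    {t : J ⊕ E} (ht : Good b f A L t) (hc : G.Covered b f A (G.head f t)) :
    ∃ t', Next b f A L t t' := by
  obtain ⟨j, hj, hjt⟩ := ht
  exact (hL _ (hc.tight hA)).exists_follows hj hjt hc.ne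

/-- The trail from the source `j` obtained by repeatedly moving on to the next token. It is
meaningful as long as the heads of its tokens are covered. -/
noncomputable def trail (b : V) (f : J → V) (A : Set J) (L : Set V → J → G.DiPath) (j : J) :
    ℕ → J ⊕ E
  | 0 => Sum.inl j
  | n + 1 =>
    -- The default of standing still never occurs for `j ∈ A` while heads are covered.
    if h : ∃ t', Next b f A L (trail b f A L j n) t' then h.choose else trail b f A L j n

/-- The first `n` tokens of the trail have covered heads. -/
def CoveredBelow (b : V) (f : J → V) (A : Set J) (L : Set V → J → G.DiPath) (j : J) (n : ℕ) :
    Prop :=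
  ∀ m < n, G.Covered b f A (G.head f (trail b f A L j m))

theorem CoveredBelow.mono {j : J} {m n : ℕ} (h : CoveredBelow b f A L j n) (hmn : m ≤ n) :
    CoveredBelow b f A L j m := fun k hk => h k (hk.trans_le hmn)

theorem trail_good_and_next (hA : G.CutCondition b f A) (hL : IsLinkageSystem b f A L) {j : J}
    (hj : j ∈ A) {n : ℕ} (h : CoveredBelow b f A L j (n + 1)) :
    Good b f A L (trail b f A L j n) ∧
      Next b f A L (trail b f A L j n) (trail b f A L j (n + 1)) := by
  suffices hg : Good b f A L (trail b f A L j n) by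
    refine ⟨hg, ?_⟩
    have := hg.exists_next hA hL (h n n.lt_succ_self)
    rw [trail, dif_pos this]
    exact this.choose_spec
  induction n with
  | zero => exact ⟨j, ⟨hj, mem_tightHull _⟩, List.mem_cons_self⟩
  | succ n ih =>
    have hg := ih (h.mono (Nat.le_succ _))
    have hn := hg.exists_next hA hL (h n (by omega))
    have hnext : Next b f A L (trail b f A L j n) (trail b f A L j (n + 1)) := by
      rw [trail, dif_pos hn]
      exact hn.choose_spec
    exact (hnext.subset_and_good hA hL (h n (by omega)) (h (n + 1) (by omega))).2

theorem trail_next (hA : G.CutCondition b f A) (hL : IsLinkageSystem b f A L) {j : J}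
    (hj : j ∈ A) {n : ℕ} (h : CoveredBelow b f A L j (n + 1)) :
    Next b f A L (trail b f A L j n) (trail b f A L j (n + 1)) :=
  (trail_good_and_next hA hL hj h).2

theorem trail_succ_eq (hA : G.CutCondition b f A) (hL : IsLinkageSystem b f A L) {j : J}
    (hj : j ∈ A) {n : ℕ} (h : CoveredBelow b f A L j (n + 1)) :
    ∃ e, trail b f A L j (n + 1) = Sum.inr e ∧ G.init e = G.head f (trail b f A L j n) := by
  obtain ⟨e, he, hi, -⟩ := (hL _ ((h n (by omega)).tight hA)).exists_edge (trail_next hA hL hj h)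
  exact ⟨e, he, hi⟩

/-- Trace both trails back; source tokens have no predecessor, so both starts are reached together.
-/
theorem trail_injective (hA : G.CutCondition b f A) (hL : IsLinkageSystem b f A L) {j j' : J}
    (hj : j ∈ A) (hj' : j' ∈ A) {n n' : ℕ} (h : CoveredBelow b f A L j n)
    (h' : CoveredBelow b f A L j' n') (heq : trail b f A L j n = trail b f A L j' n') :
    j = j' ∧ n = n' := by
  induction n generalizing n' with
  | zero =>
    cases n' with
    | zero => exact ⟨Sum.inl.inj heq, rfl⟩
    | succ n' =>
      obtain ⟨e, he, -⟩ := trail_succ_eq hA hL hj' h'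
      rw [he] at heq
      exact absurd heq Sum.inl_ne_inr
  | succ n ih =>
    cases n' with
    | zero =>
      obtain ⟨e, he, -⟩ := trail_succ_eq hA hL hj h
      rw [he] at heq
      exact absurd heq Sum.inr_ne_inl
    | succ n' =>
      have h1 := trail_next hA hL hj h
      have h2 := trail_next hA hL hj' h'
      rw [← heq] at h2
      obtain ⟨hjj, hnn⟩ := ih (h.mono (Nat.le_succ _)) (h'.mono (Nat.le_succ _))
        (h1.left_unique hA hL h2 (h n (by omega)) (h' n' (by omega)))
      exact ⟨hjj, by rw [hnn]⟩

theorem trail_hull_mono (hA : G.CutCondition b f A) (hL : IsLinkageSystem b f A L) {j : J}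
    (hj : j ∈ A) {m n : ℕ} (hmn : m ≤ n) (h : CoveredBelow b f A L j (n + 1)) :
    G.tightHull b f A (G.head f (trail b f A L j m)) ⊆
      G.tightHull b f A (G.head f (trail b f A L j n)) := by
  induction n, hmn using Nat.le_induction with
  | base => exact subset_rfl
  | succ n hmn ih =>
    have h' := h.mono (Nat.le_succ _)
    exact (ih h').trans ((trail_next hA hL hj h').subset_and_good hA hL (h n (by omega))
      (h (n + 1) (by omega))).1

/-- As long as the tight hull of the head does not change, the trail follows a single path. -/
theorem trail_follows (hA : G.CutCondition b f A) (hL : IsLinkageSystem b f A L) {j : J}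
    (hj : j ∈ A) {m : ℕ} (h : G.Covered b f A (G.head f (trail b f A L j m)))
    (hg : Good b f A L (trail b f A L j m)) :
    ∃ i ∈ A ∩ f ⁻¹' G.tightHull b f A (G.head f (trail b f A L j m)), ∃ k, ∀ r,
      CoveredBelow b f A L j (m + r) →
      (∀ q < r, G.tightHull b f A (G.head f (trail b f A L j (m + q))) =
        G.tightHull b f A (G.head f (trail b f A L j m))) →
      (tokens i (L (G.tightHull b f A (G.head f (trail b f A L j m))) i))[k + r]? =
        some (trail b f A L j (m + r)) := by
  obtain ⟨i, hi, hit⟩ := hg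
  obtain ⟨k, hk⟩ := List.mem_iff_getElem?.1 hit
  refine ⟨i, hi, k, fun r => ?_⟩
  induction r with
  | zero => exact fun _ _ => hk
  | succ r ih =>
    intro hc hr
    have h1 := ih (hc.mono (by omega)) fun q hq => hr q (by omega)
    have h2 := trail_next hA hL hj hc
    have h2 : Next b f A L (trail b f A L j (m + r)) (trail b f A L j (m + r + 1)) := h2
    unfold Next at h2
    rw [hr r (by omega)] at h2
    obtain ⟨i', hi', k', hk', hk1'⟩ := h2
    obtain ⟨rfl, rfl⟩ := (hL _ (h.tight hA)).position_unique hi hi' h1 hk'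
    exact hk1'

/-- The trail visits no vertex twice. -/
theorem trail_head_ne (hA : G.CutCondition b f A) (hL : IsLinkageSystem b f A L) {j : J}
    (hj : j ∈ A) {m n : ℕ} (hmn : m < n) (h : CoveredBelow b f A L j n) :
    G.head f (trail b f A L j m) ≠ G.head f (trail b f A L j n) := by
  intro heq
  have hcm := h m hmn
  have hc : CoveredBelow b f A L j (n + 1) := by
    intro k hk
    rcases Nat.lt_succ_iff_lt_or_eq.1 hk with hk | rfl
    · exact h k hk
    · exact heq ▸ hcm
  obtain ⟨r, rfl⟩ := Nat.exists_eq_add_of_lt hmn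
  obtain ⟨i, hi, k, hfol⟩ := trail_follows hA hL hj hcm
    (trail_good_and_next hA hL hj (hc.mono (by omega))).1
  have h0 := hfol 0 (h.mono (by omega)) (by simp)
  -- Hulls between two visits to a vertex are squeezed between equal ones, so a single path would
  -- repeat that vertex.
  have h1 := hfol (r + 1) h fun q hq => subset_antisymm
    ((trail_hull_mono hA hL hj (n := m + r + 1) (by omega) hc).trans (by rw [heq]))
    (trail_hull_mono hA hL hj (by omega) (hc.mono (by omega)))
  have hnd := (hL _ (hcm.tight hA)).nodup_map_head hi
  have e0 := congrArg (Option.map (G.head f)) h0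
  have e1 := congrArg (Option.map (G.head f)) h1
  rw [← List.getElem?_map, Option.map_some] at e0 e1
  obtain ⟨hlt, -⟩ := List.getElem?_eq_some_iff.1 e0
  have := (List.getElem?_inj hlt hnd).1 (e0.trans ((congrArg some heq).trans e1.symm))
  omega

/-- An initial segment of the trail is a path. -/
theorem exists_diPath_trail (hA : G.CutCondition b f A) (hL : IsLinkageSystem b f A L) {j : J}
    (hj : j ∈ A) {n : ℕ} (h : CoveredBelow b f A L j n) :
    ∃ P : G.DiPath, P.first = f j ∧ P.last = G.head f (trail b f A L j n) ∧
      ∀ e ∈ P.edges, ∃ m, CoveredBelow b f A L j m ∧ trail b f A L j m = Sum.inr e := by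
  have key : ∀ n, CoveredBelow b f A L j n → ∃ es : List E,
      G.IsWalk (f j) es (G.head f (trail b f A L j n)) ∧
      es.map Sum.inr = (List.range n).map fun m => trail b f A L j (m + 1) := by
    intro n
    induction n with
    | zero => exact fun _ => ⟨[], rfl, rfl⟩
    | succ n ih =>
      intro h
      obtain ⟨es, hw, hes⟩ := ih (h.mono (Nat.le_succ _))
      obtain ⟨e, he, hi⟩ := trail_succ_eq hA hL hj h
      refine ⟨es ++ [e], hw.append ⟨hi, ?_⟩, ?_⟩
      · rw [he]; rfl
      · rw [List.map_append, hes, List.range_succ, List.map_append, List.map_singleton,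
          List.map_singleton, he]
  obtain ⟨es, hw, hes⟩ := key n h
  refine ⟨⟨f j, es, _, hw, ?_⟩, rfl, rfl, ?_⟩
  · have : f j :: es.map G.ter =
        (List.range (n + 1)).map fun m => G.head f (trail b f A L j m) := by
      rw [List.range_succ_eq_map, List.map_cons, List.map_map]
      have h2 := congrArg (List.map (G.head f)) hes
      rw [List.map_map, List.map_map] at h2
      exact congrArg₂ List.cons rfl h2
    rw [this]
    refine List.Nodup.map_on ?_ List.nodup_range
    intro m hm m' hm' heq
    rw [List.mem_range] at hm hm'
    rcases lt_trichotomy m m' with hlt | rfl | hlt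
    · exact absurd heq (trail_head_ne hA hL hj hlt (h.mono (by omega)))
    · rfl
    · exact absurd heq.symm (trail_head_ne hA hL hj hlt (h.mono (by omega)))
  · intro e he
    have : Sum.inr e ∈ (List.range n).map fun m => trail b f A L j (m + 1) :=
      hes ▸ List.mem_map_of_mem he
    obtain ⟨m, hm, hme⟩ := List.mem_map.1 this
    rw [List.mem_range] at hm
    exact ⟨m + 1, h.mono (by omega), hme⟩

/-- A trail that never stops is a ray. -/
theorem exists_diRay_trail (hA : G.CutCondition b f A) (hL : IsLinkageSystem b f A L) {j : J}
    (hj : j ∈ A) (h : ∀ n, CoveredBelow b f A L j n) :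
    ∃ R : G.DiRay, (∀ n, R.vert n = G.head f (trail b f A L j n)) ∧
      ∀ n, trail b f A L j (n + 1) = Sum.inr (R.edge n) := by
  choose e he hi using fun n => trail_succ_eq hA hL hj (h (n + 1))
  refine ⟨⟨fun n => G.head f (trail b f A L j n), e, hi, fun n => ?_, ?_⟩, fun _ => rfl, he⟩
  · rw [he]; rfl
  · intro m m' heq
    rcases lt_trichotomy m m' with hlt | rfl | hlt
    · exact absurd heq (trail_head_ne hA hL hj hlt (h _))
    · rfl
    · exact absurd heq.symm (trail_head_ne hA hL hj hlt (h _))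

/-- A trail that never stops leaves every tight set. -/
theorem trail_not_subset_tight (hA : G.CutCondition b f A) (hL : IsLinkageSystem b f A L) {j : J}
    (hj : j ∈ A) (h : ∀ n, CoveredBelow b f A L j n) {X : Set V} (hX : G.Tight b f A X) :
    ∃ n, G.head f (trail b f A L j n) ∉ X := by
  by_contra! hcon
  set v : ℕ → V := fun n => G.head f (trail b f A L j n) with hv
  set H : ℕ → Set V := fun n => G.tightHull b f A (v n) with hH
  have hHt : ∀ n, G.Tight b f A (H n) := fun n => (h (n + 1) n n.lt_succ_self).tight hA
  have hHm : Monotone H := fun m n hmn => trail_hull_mono hA hL hj hmn (h _)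
  have hHX : ∀ n, H n ⊆ X := fun n => tightHull_subset hX (hcon n)
  set Y := ⋃ n, H n
  have hHY : ∀ n, H n ⊆ Y := Set.subset_iUnion H
  have hY : G.Tight b f A Y := hX.iUnion_nat hA hHt hHm hHX
  have hvH : ∀ n, v n ∈ H n := fun n => mem_tightHull _
  -- Some `H n` contains all tails of edges leaving `Y`; counting sources shows that no other edges
  -- leave `H n`. Hence the trail, which stays in `Y`, cannot leave `H n`.
  obtain ⟨n, hn⟩ := exists_index_of_finite hHm
    ((hY.finite.image G.init).union ((hY.finite_inter hA).image f))
  have hsub : G.outEdges Y ⊆ G.outEdges (H n) := fun e he =>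
    ⟨hn _ (Or.inl ⟨e, he, rfl⟩) he.1, fun h => he.2 (hHY n h)⟩
  have hle : (G.outEdges (H n)).encard ≤ (G.outEdges Y).encard := by
    refine (hHt n).le.trans ((Set.encard_le_encard ?_).trans (hA Y hY.notMem hY.finite))
    exact fun i hi => ⟨hi.1, hHY n hi.2⟩
  have heq : G.outEdges Y = G.outEdges (H n) :=
    (hHt n).finite.eq_of_subset_of_encard_le' hsub hle
  have hstay : ∀ m, n ≤ m → v m ∈ H n := by
    intro m hm
    induction m, hm using Nat.le_induction with
    | base => exact hvH n
    | succ m hm ih =>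
      by_contra hout
      obtain ⟨e, he, hi⟩ := trail_succ_eq hA hL hj (h (m + 1))
      have hter : v (m + 1) = G.ter e := by simp only [hv]; rw [he]; rfl
      have hmem : e ∈ G.outEdges (H n) := ⟨by rw [hi]; exact ih, by rw [← hter]; exact hout⟩
      rw [← heq] at hmem
      exact hmem.2 (hter ▸ hHY _ (hvH (m + 1)))
  obtain ⟨i, -, k, hfol⟩ := trail_follows hA hL hj (h (n + 1) n n.lt_succ_self)
    (trail_good_and_next hA hL hj (h (n + 1))).1
  -- With the hull constant, the trail would run past the end of a finite path.
  have h1 := hfol (tokens i (L (H n) i)).length (h _) fun q _ => subset_antisymm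
    (tightHull_subset (hHt n) (hstay _ (by omega))) (hHm (by omega))
  obtain ⟨h2, -⟩ := List.getElem?_eq_some_iff.1 h1
  simp only [hH, hv] at h2
  omega

end Trails

/-! ### Domination, cuts and the construction of the linkage -/

section Domination

open Classical

variable {V E : Type*} {G : MultiDigraph V E} {b : V}

theorem DiPath.exists_mem_outEdges {P : G.DiPath} {X : Set V} (h : P.first ∈ X)
    (h' : P.last ∉ X) : ∃ e ∈ P.edgeSet, e ∈ G.outEdges X :=
  P.isWalk.exists_mem_outEdges h h'

theorem DiRay.exists_mem_outEdges {R : G.DiRay} {X : Set V} (h : R.vert 0 ∈ X) {n : ℕ}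
    (hn : R.vert n ∉ X) : ∃ e ∈ Set.range R.edge, e ∈ G.outEdges X := by
  induction n with
  | zero => exact absurd h hn
  | succ n ih =>
    by_cases hX : R.vert n ∈ X
    · exact ⟨R.edge n, ⟨n, rfl⟩, by rw [R.init_edge]; exact hX, by rw [R.ter_edge]; exact hn⟩
    · exact ih hX

/-- Infinitely many edge-disjoint paths cannot cross a finite cut. -/
theorem InfinitelyManyPaths.infinite_outEdges {R X : Set V} (h : G.InfinitelyManyPaths R {b})
    (hR : R ⊆ X) (hb : b ∉ X) : (G.outEdges X).Infinite := by
  obtain ⟨L, hL, hends, hdisj⟩ := h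
  have : ∀ P : L, ∃ e ∈ P.1.edgeSet, e ∈ G.outEdges X := fun P =>
    P.1.exists_mem_outEdges (hR (hends P P.2).1) (by rw [(hends P P.2).2]; exact hb)
  choose g hg hgX using this
  have := hL.to_subtype
  refine (Set.infinite_range_of_injective (f := g) ?_).mono (by rintro _ ⟨P, rfl⟩; exact hgX P)
  intro P Q hPQ
  by_contra hne
  exact Set.disjoint_left.1 (hdisj P P.2 Q Q.2 fun h => hne (Subtype.ext h)) (hg P)
    (hPQ ▸ hg Q)

/-- If no finite cut separates `R` from `b`, there are infinitely many edge-disjoint paths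
from `R` to `b`. -/
theorem infinitelyManyPaths_of_infinite_outEdges {R : Set V} (hbR : b ∉ R)
    (h : ∀ X, R ⊆ X → b ∉ X → (G.outEdges X).Infinite) : G.InfinitelyManyPaths R {b} := by
  obtain ⟨L, hL⟩ := zorn_subset {L : Set G.DiPath | (∀ P ∈ L, P.first ∈ R ∧ P.last ∈ ({b} : Set V)) ∧
      ∀ P ∈ L, ∀ Q ∈ L, P ≠ Q → Disjoint P.edgeSet Q.edgeSet} (by
    intro c hc hchain
    refine ⟨⋃₀ c, ⟨?_, ?_⟩, fun s hs => Set.subset_sUnion_of_mem hs⟩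
    · rintro P ⟨M, hM, hP⟩
      exact (hc hM).1 P hP
    · rintro P ⟨M, hM, hP⟩ Q ⟨N, hN, hQ⟩ hne
      rcases hchain.total hM hN with hMN | hNM
      · exact (hc hN).2 P (hMN hP) Q hQ hne
      · exact (hc hM).2 P hP Q (hNM hQ) hne)
  refine ⟨L, fun hfin => ?_, hL.prop.1, hL.prop.2⟩
  -- If `L` is finite, either a further path avoids its edges or they contain a cut.
  set F : Set E := ⋃ P ∈ L, P.edgeSet
  have hFfin : F.Finite := hfin.biUnion fun P _ => P.edges.finite_toSet
  set X := G.reachable (fun e => e ∉ F) R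
  by_cases hb : b ∈ X
  · obtain ⟨u, hu, es, hw, hes⟩ := hb
    obtain ⟨P, hPf, hPl, hP⟩ := hw.exists_diPath
    have hPF : ∀ Q ∈ L, Disjoint P.edgeSet Q.edgeSet := fun Q hQ =>
      Set.disjoint_left.2 fun e he he' => hes e (hP he) (Set.mem_biUnion hQ he')
    have hPL : P ∈ L := by
      refine hL.le_of_ge (y := insert P L) ⟨?_, ?_⟩ (Set.subset_insert _ _) (Set.mem_insert _ _)
      · rintro Q (rfl | hQ)
        · exact ⟨hPf ▸ hu, hPl⟩
        · exact hL.prop.1 Q hQ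
      · rintro Q (rfl | hQ) Q' (rfl | hQ') hne
        · exact absurd rfl hne
        · exact hPF Q' hQ'
        · exact (hPF Q hQ).symm
        · exact hL.prop.2 Q hQ Q' hQ' hne
    -- `P` would be disjoint from itself, yet it has an edge since `b ∉ R`.
    obtain ⟨e, he, -⟩ := P.exists_mem_outEdges (X := R) (hPf ▸ hu) (hPl ▸ hbR)
    exact Set.disjoint_left.1 (hPF P hPL) he he
  · refine h X (subset_reachable _ _) hb (hFfin.subset fun e he => ?_)
    by_contra heF
    exact he.2 (ter_mem_reachable he.1 heF)

/-- Dominating `b` from within `X` would require infinitely many edges leaving `X`. -/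
theorem PathOrRay.EndsInOrDominates.exists_mem_outEdges {Q : G.PathOrRay}
    (h : Q.EndsInOrDominates {b}) {X : Set V} (hf : Q.first ∈ X) (hb : b ∉ X)
    (hX : (G.outEdges X).Finite) : ∃ e ∈ Q.edgeSet, e ∈ G.outEdges X := by
  cases Q with
  | path P =>
    refine P.exists_mem_outEdges hf fun hl => ?_
    rcases h with h | h
    · exact hb (Set.mem_singleton_iff.1 h ▸ hl)
    · exact InfinitelyManyPaths.infinite_outEdges h (Set.singleton_subset_iff.2 hl) hb hX
  | ray R =>
    have : ∃ n, R.vert n ∉ X := by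
      by_contra! hcon
      exact InfinitelyManyPaths.infinite_outEdges h (by rintro _ ⟨n, rfl⟩; exact hcon n) hb hX
    obtain ⟨n, hn⟩ := this
    exact R.exists_mem_outEdges hf hn

theorem encard_inter_le_of_crossing {S X : Set V} (D : S → Set E)
    (hD : ∀ s s' : S, s ≠ s' → Disjoint (D s) (D s'))
    (hX : ∀ s : S, s.1 ∈ X → ∃ e ∈ D s, e ∈ G.outEdges X) :
    (S ∩ X).encard ≤ (G.outEdges X).encard := by
  have : ∀ s : ↥(S ∩ X), ∃ e ∈ D ⟨s, s.2.1⟩, e ∈ G.outEdges X := fun s => hX ⟨s, s.2.1⟩ s.2.2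
  choose g hg hgX using this
  refine Function.Embedding.encard_le ⟨fun s => ⟨g s, hgX s⟩, fun s s' h => ?_⟩
  by_contra hne
  have h : g s = g s' := congrArg Subtype.val h
  refine Set.disjoint_left.1 (hD ⟨s, s.2.1⟩ ⟨s', s'.2.1⟩ fun h => hne ?_) (hg s) (h ▸ hg s')
  exact Subtype.ext (congrArg Subtype.val h :)

theorem IsDominationLinkage.cutCondition {I : Set V} {Q : I → G.PathOrRay}
    (hQ : IsDominationLinkage I {b} Q) : G.CutCondition b id I := fun X hb hX =>
  encard_inter_le_of_crossing (fun a => (Q a).edgeSet) hQ.disjoint fun a ha =>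
    (hQ.ends_or_dominates a).exists_mem_outEdges (by rw [hQ.first_eq]; exact ha) hb hX

theorem IsLinkage.cutCondition {S : Set V} {P : S → G.DiPath} (hP : IsLinkage S {b} P) :
    G.CutCondition b id S := fun X hb _ =>
  encard_inter_le_of_crossing (fun a => (P a).edgeSet) hP.disjoint fun a ha =>
    (P a).exists_mem_outEdges (by rw [hP.first_eq]; exact ha)
      (by rw [Set.mem_singleton_iff.1 (hP.last_mem a)]; exact hb)

theorem CutCondition.exists_isLinkage {I S : Set V} (hI : G.CutCondition b id I) (hSI : S ⊆ I)
    (hS : S.Finite) : ∃ P : S → G.DiPath, IsLinkage S {b} P := by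
  obtain ⟨F, hF⟩ := hI.exists_isFlow (S := hS.toFinset) (by rwa [hS.coe_toFinset])
  obtain ⟨P, hP⟩ := hF.exists_isLinked
  have hmem : ∀ a : S, a.1 ∈ hS.toFinset := fun a => hS.mem_toFinset.2 a.2
  exact ⟨fun a => P a, fun a => hP.first_eq a (hmem a), fun a => hP.last_eq a (hmem a),
    fun a a' hne => hP.disjoint a (hmem a) a' (hmem a') fun h => hne (Subtype.ext h)⟩

theorem cutCondition_of_finite_subsets {I : Set V}
    (h : ∀ S ⊆ I, S.Finite → G.CutCondition b id S) : G.CutCondition b id I := by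
  intro X hb hX
  by_contra! hlt
  obtain ⟨t, ht, htc⟩ := Set.exists_subset_encard_eq (Order.add_one_le_of_lt hlt)
  have htf : t.Finite := by
    rw [← Set.encard_lt_top_iff, htc, ENat.add_lt_top]
    exact ⟨hX.encard_lt_top, by simp⟩
  have h1 := h t (fun s hs => (ht hs).1) htf X hb hX
  rw [Set.inter_eq_left.2 fun s hs => (ht hs).2, htc, ← hX.cast_ncard_eq] at h1
  have h1 : (G.outEdges X).ncard + 1 ≤ (G.outEdges X).ncard := by exact_mod_cast h1
  omega

/-- Pairs leave room for several sources at one vertex; a single copy of each changes no count. -/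
theorem CutCondition.image_prodMk {I : Set V} (hI : G.CutCondition b id I) (n : ℕ) :
    G.CutCondition b Prod.fst ((fun v : V => (v, n)) '' I) := by
  intro X hb hX
  refine le_trans ?_ (hI X hb hX)
  rw [← (show Function.Injective fun v : V => (v, n) from
    fun _ _ h => (Prod.mk.inj h).1).encard_image (I ∩ id ⁻¹' X)]
  refine Set.encard_le_encard ?_
  rintro _ ⟨⟨v, hv, rfl⟩, hX⟩
  exact ⟨v, ⟨hv, hX⟩, rfl⟩

/-- A set of sources satisfying the cut condition has a domination linkage, if every set with
finitely many outgoing edges is covered by tight sets. -/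
theorem CutCondition.exists_pathOrRay {J : Type*} {f : J → V} {A : Set J}
    (hA : G.CutCondition b f A)
    (hcov : ∀ X, b ∉ X → (G.outEdges X).Finite → ∀ v ∈ X, G.Covered b f A v) :
    ∃ Q : J → G.PathOrRay, ∀ j ∈ A, (Q j).first = f j ∧ (Q j).EndsInOrDominates {b} ∧
      ∀ j' ∈ A, j ≠ j' → Disjoint (Q j).edgeSet (Q j').edgeSet := by
  have : ∀ T, ∃ P : J → G.DiPath, G.Tight b f A T → IsTightLinkage b f A T P := fun T =>
    if hT : G.Tight b f A T then
      let ⟨P, hP⟩ := hT.exists_isTightLinkage hA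
      ⟨P, fun _ => hP⟩
    else ⟨fun _ => ⟨b, [], b, rfl, by simp⟩, fun h => absurd h hT⟩
  choose L hL using this
  have hL : IsLinkageSystem b f A L := hL
  suffices ∀ j, ∃ Q : G.PathOrRay, j ∈ A → Q.first = f j ∧ Q.EndsInOrDominates {b} ∧
      ∀ e ∈ Q.edgeSet, ∃ m, CoveredBelow b f A L j m ∧ trail b f A L j m = Sum.inr e by
    choose Q hQ using this
    refine ⟨Q, fun j hj => ⟨(hQ j hj).1, (hQ j hj).2.1, fun j' hj' hne => ?_⟩⟩
    rw [Set.disjoint_left]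
    intro e he he'
    obtain ⟨m, hm, hme⟩ := (hQ j hj).2.2 e he
    obtain ⟨m', hm', hme'⟩ := (hQ j' hj').2.2 e he'
    exact hne (trail_injective hA hL hj hj' hm hm' (hme.trans hme'.symm)).1
  intro j
  by_cases hj : j ∈ A
  swap
  · exact ⟨.path ⟨b, [], b, rfl, by simp⟩, fun h => absurd h hj⟩
  by_cases hall : ∀ n, G.Covered b f A (G.head f (trail b f A L j n))
  · have hc : ∀ n, CoveredBelow b f A L j n := fun n m _ => hall m
    obtain ⟨R, hRv, hRe⟩ := exists_diRay_trail hA hL hj hc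
    refine ⟨.ray R, fun _ => ⟨hRv 0, ?_, ?_⟩⟩
    · refine infinitelyManyPaths_of_infinite_outEdges ?_ fun X hRX hb hX => ?_
      · rintro ⟨n, hn⟩
        exact (hall n).ne ((hRv n).symm.trans hn)
      · obtain ⟨T, hT, hXT⟩ := exists_tight_superset hA hcov hb hX
        obtain ⟨n, hn⟩ := trail_not_subset_tight hA hL hj hc hT
        exact hn (hXT (hRX ⟨n, hRv n⟩))
    · rintro _ ⟨n, rfl⟩
      exact ⟨n + 1, hc _, hRe n⟩
  · push Not at hall
    obtain ⟨P, hPf, hPl, hPe⟩ := exists_diPath_trail hA hL hj (n := Nat.find hall)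
      fun m hm => not_not.1 (Nat.find_min hall hm)
    refine ⟨.path P, fun _ => ⟨hPf, ?_, hPe⟩⟩
    have hn := Nat.find_spec hall
    rw [← hPl] at hn
    by_cases hb : P.last = b
    · exact Or.inl hb
    -- A finite cut around the last vertex would make it covered.
    · refine Or.inr (infinitelyManyPaths_of_infinite_outEdges (fun h => hb h.symm)
        fun X hX hbX hfin => hn (hcov X hbX hfin _ (hX rfl)))

end Domination

end MultiDigraph

theorem theorem2p1 {V E : Type*} (G : MultiDigraph V E) (b : V) (I : Set V) (hI : b ∉ I) :
    (∃ Q : I → G.PathOrRay, MultiDigraph.IsDominationLinkage I {b} Q) ↔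
      ∀ S : Set V, S ⊆ I → S.Finite →
        ∃ P : S → G.DiPath, MultiDigraph.IsLinkage S {b} P := by
  constructor
  · rintro ⟨Q, hQ⟩ S hSI hS
    exact hQ.cutCondition.exists_isLinkage hSI hS
  · intro h
    have hcut : G.CutCondition b id I := MultiDigraph.cutCondition_of_finite_subsets
      fun S hSI hS => (h S hSI hS).choose_spec.cutCondition
    -- The sources added here only create tight sets; their paths and rays are discarded.
    obtain ⟨M, hIM, hM, hmax⟩ := (hcut.image_prodMk 0).exists_maximal
    obtain ⟨Q, hQ⟩ := hM.exists_pathOrRay fun X hb hX v hv =>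
      MultiDigraph.exists_tight_of_maximal hM hmax hb hX hv
    have hmem : ∀ a : I, (a.1, 0) ∈ M := fun a => hIM ⟨a, a.2, rfl⟩
    refine ⟨fun a => Q (a, 0), fun a => (hQ _ (hmem a)).1, fun a => (hQ _ (hmem a)).2.1,
      fun a a' hne => (hQ _ (hmem a)).2.2 _ (hmem a') fun h => hne ?_⟩
    exact Subtype.ext (Prod.mk.inj h).1
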